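/- Theorem (explicit van der Corput $d$-th derivative test). Write $e(x)=e^{2\pi i x}$. For every integer $d\ge 3$ there are positive real constants $A_d<7.5$, $B_d<5.8$, $C_d<10.9$, depending only on $d$, such that the following holds. Let $X,Y\in\mathbb{R}$ with $\lfloor Y\rfloor>d$, let $f\colon(X,X+Y]\to\mathbb{R}$ have continuous derivatives up to order $d$ (one-sided at the right end point $X+Y$), and suppose that $0<\lambda\le f^{(d)}(x)\le\Lambda$ for all $X<x\le X+Y$. Put $D=2^d$. Then $$\Bigl|\frac1Y\sum_{X<n\le X+Y}e(f(n))\Bigr|\le\max\Bigl\{A_d\Bigl(\frac{\Lambda}{\lambda Y}\Bigr)^{2/D},\;B_d\Bigl(\frac{\Lambda^2}{\lambda}\Bigr)^{1/(D-2)},\;C_d\,(\lambda Y^d)^{-2/D}\Bigr\},$$ where $n$ runs over the integers with $X<n\le X+Y$. -/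

import Mathlib

/-- The additive character `e(x) = exp(2πix)`. -/
noncomputable def expChar (x : ℝ) : ℂ :=
  Complex.exp (2 * Real.pi * Complex.I * x)

/-- The sum of `e(f(n))` over all integers `n` with `X < n ≤ X + Y`
(for an integer `n` these inequalities say `⌊X⌋ < n ≤ ⌊X + Y⌋`). -/
noncomputable def expSum (f : ℝ → ℝ) (X Y : ℝ) : ℂ :=
  ∑ n ∈ Finset.Ioc ⌊X⌋ ⌊X + Y⌋, expChar (f (n : ℝ))

/-! The estimate concerns real sequences whose `d`-th forward difference lies in `[l, L]`; repeated
use of the mean value theorem transfers the bounds on `f^(d)` to the sequence `f(n)`.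

For second differences, the first differences increase steadily. Away from integers the sum is
controlled by Kusmin–Landau, and near integers few terms occur. A Weyl–van der Corput step
(`norm_sum_expChar_sq_le`) bounds the square of a sum by an average over shifts `h < H` of sums over
`a(n+h) - a(n)`, whose differences of one order less lie in `[h l, h L]`. This gives order three
from order two, and then every order by induction.

The constants stay bounded because the induction carries a target `m`, with sum at most `m N`, in
place of an explicit maximum. Differenced sums are allotted the target `m²/5.75 · (H/h)^(1/2^k)`.
The weight cancels `h` in the third hypothesis and averages to at most `4/3`. Since `4 · 4/3 <
5.75`, the step closes with the same three constants. The range for `H` is nonempty by the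
hypotheses on `m`. -/

theorem expChar_add (x y : ℝ) : expChar (x + y) = expChar x * expChar y := by
  unfold expChar
  rw [← Complex.exp_add]
  push_cast
  ring_nf

theorem expChar_intCast (k : ℤ) : expChar k = 1 := by
  unfold expChar
  rw [← Complex.exp_int_mul_two_pi_mul_I k]
  push_cast
  ring_nf

theorem norm_expChar (x : ℝ) : ‖expChar x‖ = 1 := by
  unfold expChar
  rw [show (2 * Real.pi * Complex.I * x : ℂ) = ((2 * Real.pi * x : ℝ) : ℂ) * Complex.I by
    push_cast; ring]
  exact Complex.norm_exp_ofReal_mul_I _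

theorem star_expChar (x : ℝ) : (starRingEnd ℂ) (expChar x) = expChar (-x) := by
  unfold expChar
  rw [← Complex.exp_conj]
  simp [Complex.conj_ofNat]

theorem expChar_sub (x y : ℝ) : expChar (x - y) = expChar x * (starRingEnd ℂ) (expChar y) := by
  rw [star_expChar, ← expChar_add, sub_eq_add_neg]

/-! ### Kusmin–Landau inequality -/

/-- The value `1 / (1 - e(θ))`, written with the cotangent. -/
noncomputable def cotCoeff (t : ℝ) : ℂ :=
  (1 + Complex.I * ((Real.cos (Real.pi * t) / Real.sin (Real.pi * t) : ℝ) : ℂ)) / 2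

theorem cotCoeff_mul_one_sub_expChar {t : ℝ} (ht : Real.sin (Real.pi * t) ≠ 0) :
    cotCoeff t * (1 - expChar t) = 1 := by
  have he : expChar t = (Real.cos (Real.pi * t) + Real.sin (Real.pi * t) * Complex.I) ^ 2 := by
    unfold expChar
    rw [Complex.ofReal_cos, Complex.ofReal_sin, ← Complex.exp_mul_I, ← Complex.exp_nat_mul]
    push_cast
    ring_nf
  have hs : (Real.sin (Real.pi * t) : ℂ) ≠ 0 := by exact_mod_cast ht
  have h1 : (Real.cos (Real.pi * t) : ℂ) ^ 2 = 1 - (Real.sin (Real.pi * t) : ℂ) ^ 2 := by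
    have := Real.sin_sq_add_cos_sq (Real.pi * t)
    rw [eq_sub_iff_add_eq']
    exact_mod_cast this
  rw [he, cotCoeff, Complex.ofReal_div]
  generalize (Real.sin (Real.pi * t) : ℂ) = s at *
  generalize (Real.cos (Real.pi * t) : ℂ) = c at *
  have hI := Complex.I_sq
  have h2 : 1 - (c + s * Complex.I) ^ 2 = 2 * s * (s - c * Complex.I) := by
    linear_combination -h1 - s ^ 2 * hI
  rw [h2]
  field_simp
  linear_combination h1 - c ^ 2 * hI

theorem norm_cotCoeff {t : ℝ} (ht : 0 < Real.sin (Real.pi * t)) :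
    ‖cotCoeff t‖ = 1 / (2 * Real.sin (Real.pi * t)) := by
  have h1 := Real.sin_sq_add_cos_sq (Real.pi * t)
  have h : ‖cotCoeff t‖ ^ 2 = (1 / (2 * Real.sin (Real.pi * t))) ^ 2 := by
    rw [Complex.sq_norm, Complex.normSq_apply]
    simp only [cotCoeff, Complex.div_ofNat_re, Complex.div_ofNat_im, Complex.add_re, Complex.add_im,
      Complex.one_re, Complex.one_im, Complex.mul_re, Complex.mul_im, Complex.I_re, Complex.I_im,
      Complex.ofReal_re, Complex.ofReal_im]
    field_simp
    nlinarith
  exact (pow_left_inj₀ (norm_nonneg _) (one_div_nonneg.2 (by linarith)) two_ne_zero).1 h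

theorem two_mul_le_sin_pi_mul {δ t : ℝ} (h0 : 0 < δ) (h1 : δ ≤ t) (h2 : t ≤ 1 - δ) :
    2 * δ ≤ Real.sin (Real.pi * t) := by
  have hpi := Real.pi_pos
  rcases le_total t (1 / 2) with h | h
  · have := Real.mul_le_sin (x := Real.pi * t) (by nlinarith) (by nlinarith)
    have e : 2 / Real.pi * (Real.pi * t) = 2 * t := by field_simp
    linarith
  · have := Real.mul_le_sin (x := Real.pi * (1 - t)) (by nlinarith) (by nlinarith)
    have e : 2 / Real.pi * (Real.pi * (1 - t)) = 2 * (1 - t) := by field_simp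
    rw [show Real.pi * t = Real.pi - Real.pi * (1 - t) by ring, Real.sin_pi_sub]
    linarith

theorem cot_antitone {s t : ℝ} (h0 : 0 < s) (h1 : s ≤ t) (h2 : t < 1) :
    Real.cos (Real.pi * t) / Real.sin (Real.pi * t) ≤
      Real.cos (Real.pi * s) / Real.sin (Real.pi * s) := by
  have hpi := Real.pi_pos
  have hs : 0 < Real.sin (Real.pi * s) :=
    Real.sin_pos_of_pos_of_lt_pi (by positivity) (by nlinarith)
  have ht : 0 < Real.sin (Real.pi * t) :=
    Real.sin_pos_of_pos_of_lt_pi (by nlinarith) (by nlinarith)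
  have h := Real.sin_nonneg_of_nonneg_of_le_pi (x := Real.pi * t - Real.pi * s)
    (by nlinarith) (by nlinarith)
  rw [Real.sin_sub] at h
  rw [div_le_div_iff₀ ht hs]
  linarith

/-- Kusmin–Landau inequality for sequences. -/
theorem norm_sum_expChar_le_of_monotone_diff (a : ℕ → ℝ) (k : ℤ) (δ : ℝ) (L : ℕ) (hδ : 0 < δ)
    (hlo : ∀ n < L, k + δ ≤ a (n + 1) - a n) (hhi : ∀ n < L, a (n + 1) - a n ≤ k + 1 - δ)
    (hmono : ∀ n, n + 1 < L → a (n + 1) - a n ≤ a (n + 2) - a (n + 1)) :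
    ‖∑ n ∈ Finset.range L, expChar (a n)‖ ≤ 1 / δ := by
  rcases Nat.eq_zero_or_pos L with rfl | hL
  · simpa using hδ.le
  set t : ℕ → ℝ := fun n => a (n + 1) - a n - k with ht
  set u : ℕ → ℝ := fun n => Real.cos (Real.pi * t n) / Real.sin (Real.pi * t n) with hu
  have hsin : ∀ n < L, 2 * δ ≤ Real.sin (Real.pi * t n) := fun n hn =>
    two_mul_le_sin_pi_mul hδ (by simp only [ht]; linarith [hlo n hn])
      (by simp only [ht]; linarith [hhi n hn])
  have hz : ∀ n < L, expChar (a n) = cotCoeff (t n) * (expChar (a n) - expChar (a (n + 1))) := by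
    intro n hn
    have h1 := cotCoeff_mul_one_sub_expChar (t := t n) (by linarith [hsin n hn])
    have h2 : expChar (a (n + 1)) = expChar (a n) * expChar (t n) := by
      have : a (n + 1) = a n + t n + k := by simp only [ht]; ring
      rw [this, expChar_add, expChar_add, expChar_intCast, mul_one]
    rw [h2]
    linear_combination -expChar (a n) * h1
  -- Partial summation. The coefficients have constant real part `1/2`, so their increments are
  -- purely imaginary; as the cotangent is monotone, the total variation telescopes.
  have key : ∀ l, l < L → ‖∑ n ∈ Finset.range (l + 1), expChar (a n)
      - cotCoeff (t 0) * expChar (a 0) + cotCoeff (t l) * expChar (a (l + 1))‖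
        ≤ (u 0 - u l) / 2 := by
    intro l
    induction l with
    | zero =>
      intro h
      have := hz 0 h
      simp only [zero_add, Finset.range_one, Finset.sum_singleton, sub_self, zero_div]
      rw [show expChar (a 0) - cotCoeff (t 0) * expChar (a 0) + cotCoeff (t 0) * expChar (a 1) = 0
        by simp only [zero_add] at this; linear_combination this]
      simp
    | succ l ih =>
      intro h
      have h1 := ih (by omega)
      rw [Finset.sum_range_succ]
      have h2 := hz (l + 1) h
      have h3 : ∑ n ∈ Finset.range (l + 1), expChar (a n) + expChar (a (l + 1))
          - cotCoeff (t 0) * expChar (a 0) + cotCoeff (t (l + 1)) * expChar (a (l + 1 + 1))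
          = (∑ n ∈ Finset.range (l + 1), expChar (a n)
      - cotCoeff (t 0) * expChar (a 0) + cotCoeff (t l) * expChar (a (l + 1))) +
        (cotCoeff (t (l + 1)) - cotCoeff (t l)) * expChar (a (l + 1)) := by
        linear_combination h2
      rw [h3]
      have h4 : cotCoeff (t (l + 1)) - cotCoeff (t l) =
          Complex.I * (((u (l + 1) - u l) / 2 : ℝ) : ℂ) := by
        simp only [cotCoeff, hu]
        push_cast
        ring
      have h5 : u (l + 1) ≤ u l := by
        apply cot_antitone
        · simp only [ht]; linarith [hlo l (by omega)]
        · simp only [ht]; linarith [hmono l h]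
        · simp only [ht]; linarith [hhi (l + 1) h]
      have h6 : ‖(cotCoeff (t (l + 1)) - cotCoeff (t l)) * expChar (a (l + 1))‖
          = (u l - u (l + 1)) / 2 := by
        rw [h4, norm_mul, norm_expChar, mul_one, norm_mul, Complex.norm_I, one_mul,
          Complex.norm_real, Real.norm_eq_abs, abs_of_nonpos (by linarith)]
        ring
      refine (norm_add_le _ _).trans ?_
      rw [h6]
      linarith
  obtain ⟨l, rfl⟩ : ∃ l, L = l + 1 := ⟨L - 1, by omega⟩
  have hk := key l (by omega)
  -- The variation `(u 0 - u l) / 2` costs at most `1/(2δ)` and the two boundary coefficients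
  -- `1/(4δ)` each, `1/δ` in all.
  have hc : ∀ n < l + 1, ‖cotCoeff (t n)‖ ≤ 1 / (4 * δ) ∧ |u n| ≤ 1 / (2 * δ) := by
    intro n hn
    have h := hsin n hn
    have hp : 0 < Real.sin (Real.pi * t n) := by linarith
    constructor
    · rw [norm_cotCoeff hp]
      exact one_div_le_one_div_of_le (by positivity) (by linarith)
    · simp only [hu]
      rw [abs_div, abs_of_pos hp]
      exact div_le_div₀ zero_le_one (Real.abs_cos_le_one _) (by positivity) h
  have h0 := hc 0 (by omega)
  have h1 := hc l (by omega)
  have h2 : ‖∑ n ∈ Finset.range (l + 1), expChar (a n)‖ ≤ (u 0 - u l) / 2 + ‖cotCoeff (t 0)‖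
      + ‖cotCoeff (t l)‖ := by
    calc _ = ‖(∑ n ∈ Finset.range (l + 1), expChar (a n)
          - cotCoeff (t 0) * expChar (a 0) + cotCoeff (t l) * expChar (a (l + 1)))
          + cotCoeff (t 0) * expChar (a 0) - cotCoeff (t l) * expChar (a (l + 1))‖ := by
          congr 1; ring
      _ ≤ _ := by
        refine (norm_sub_le _ _).trans ?_
        rw [norm_mul (cotCoeff (t l)), norm_expChar, mul_one]
        gcongr
        refine (norm_add_le _ _).trans ?_
        rw [norm_mul, norm_expChar, mul_one]
        gcongr
  have h3 := abs_le.1 h0.2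
  have h4 := abs_le.1 h1.2
  have e1 : 1 / (4 * δ) = (1 / δ) / 4 := by field_simp
  have e2 : 1 / (2 * δ) = (1 / δ) / 2 := by field_simp
  rw [e1] at h0 h1
  rw [e2] at h3 h4
  linarith [h0.1, h1.1, h3.2, h4.1]

/-! ### Second derivative test for sequences -/

theorem filter_range_eq_range_card (p : ℕ → Prop) [DecidablePred p] (L : ℕ)
    (h : ∀ i j, i ≤ j → j < L → p j → p i) :
    (Finset.range L).filter p = Finset.range ((Finset.range L).filter p).card := by
  induction L with
  | zero => simp
  | succ L ih =>
    have h1 := ih fun i j hij hj => h i j hij (by omega)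
    rw [Finset.range_add_one, Finset.filter_insert]
    split_ifs with hp
    · have : (Finset.range L).filter p = Finset.range L :=
        Finset.filter_true_of_mem fun i hi => h i L (Finset.mem_range.1 hi).le (by omega) hp
      rw [this, Finset.card_insert_of_notMem (by simp), Finset.card_range, Finset.range_add_one]
    · exact h1

/-- For a sequence that increases on `[0, L)`, the indices with values in `[u, v)` form an interval. -/
theorem exists_filter_eq_Ico (t : ℕ → ℝ) (L : ℕ) (ht : ∀ i j, i ≤ j → j < L → t i ≤ t j) (u v : ℝ) :
    ∃ p q, (Finset.range L).filter (fun n => u ≤ t n ∧ t n < v) = Finset.Ico p q := by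
  refine ⟨((Finset.range L).filter (fun n => t n < u)).card,
    ((Finset.range L).filter (fun n => t n < v)).card, ?_⟩
  have h1 := filter_range_eq_range_card (fun n => t n < u) L
    fun i j hij hj h => (ht i j hij hj).trans_lt h
  have h2 := filter_range_eq_range_card (fun n => t n < v) L
    fun i j hij hj h => (ht i j hij hj).trans_lt h
  ext n
  rw [Finset.mem_Ico]
  have e1 : n < ((Finset.range L).filter (fun n => t n < u)).card ↔ n < L ∧ t n < u := by
    rw [← Finset.mem_range, ← h1]; simp
  have e2 : n < ((Finset.range L).filter (fun n => t n < v)).card ↔ n < L ∧ t n < v := by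
    rw [← Finset.mem_range, ← h2]; simp
  rw [e2, ← not_lt, e1]
  simp only [Finset.mem_filter, Finset.mem_range, not_and, not_lt]
  tauto

theorem norm_sum_expChar_le_card (s : Finset ℕ) (a : ℕ → ℝ) :
    ‖∑ n ∈ s, expChar (a n)‖ ≤ s.card := by
  refine (norm_sum_le _ _).trans ?_
  simp [norm_expChar]

/-- A sum over the indices at which the first difference lies within `[k - δ, k + 1 - δ)`. -/
theorem norm_sum_expChar_block_le (a : ℕ → ℝ) (L : ℕ) (μ δ : ℝ) (k : ℤ) (hμ : 0 < μ) (hδ : 0 < δ)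
    (hδ2 : δ ≤ 1 / 2)
    (hlow : ∀ i j, i ≤ j → j < L → (a (i + 1) - a i) + (j - i) * μ ≤ a (j + 1) - a j) :
    ‖∑ n ∈ (Finset.range L).filter (fun n => ⌊a (n + 1) - a n + δ⌋ = k), expChar (a n)‖ ≤
      2 * δ / μ + 1 + 1 / δ := by
  set t : ℕ → ℝ := fun n => a (n + 1) - a n with ht
  have hmono : ∀ i j, i ≤ j → j < L → t i ≤ t j := fun i j hij hj => by
    have := hlow i j hij hj
    have h2 : (i : ℝ) ≤ j := by exact_mod_cast hij
    have : 0 ≤ ((j : ℝ) - i) * μ := mul_nonneg (by linarith) hμ.le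
    simp only [ht]; linarith
  obtain ⟨p, q, hpq⟩ := exists_filter_eq_Ico t L hmono (k - δ) (k + δ)
  obtain ⟨r, s, hrs⟩ := exists_filter_eq_Ico t L hmono (k + δ) (k + 1 - δ)
  -- Differences within `δ` of `k` are counted through their growth by `μ` per step; the rest stay
  -- `δ` away from integers and fall under Kusmin–Landau.
  have hsplit : (Finset.range L).filter (fun n => ⌊a (n + 1) - a n + δ⌋ = k) =
      Finset.Ico p q ∪ Finset.Ico r s := by
    rw [← hpq, ← hrs]
    ext n
    simp only [Finset.mem_filter, Finset.mem_union, Int.floor_eq_iff, ht]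
    constructor
    · rintro ⟨h1, h2, h3⟩
      rcases lt_or_ge (a (n + 1) - a n) (k + δ) with h | h
      · exact Or.inl ⟨h1, by linarith, h⟩
      · exact Or.inr ⟨h1, h, by linarith⟩
    · rintro (⟨h1, h2, h3⟩ | ⟨h1, h2, h3⟩)
      · exact ⟨h1, by linarith, by linarith⟩
      · exact ⟨h1, by linarith, by linarith⟩
  have hdisj : Disjoint (Finset.Ico p q) (Finset.Ico r s) := by
    rw [← hpq, ← hrs, Finset.disjoint_left]
    intro n h1 h2
    simp only [Finset.mem_filter] at h1 h2
    linarith [h1.2.2, h2.2.1]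
  rw [hsplit, Finset.sum_union hdisj]
  refine (norm_add_le _ _).trans (add_le_add ?_ ?_)
  · refine (norm_sum_expChar_le_card _ _).trans ?_
    rw [Nat.card_Ico]
    rcases le_or_gt q p with h | h
    · rw [Nat.sub_eq_zero_of_le h]
      push_cast
      positivity
    · have m1 : p ∈ Finset.Ico p q := Finset.mem_Ico.2 ⟨le_rfl, h⟩
      have m2 : q - 1 ∈ Finset.Ico p q := Finset.mem_Ico.2 ⟨by omega, by omega⟩
      rw [← hpq, Finset.mem_filter, Finset.mem_range] at m1 m2
      have h3 := hlow p (q - 1) (by omega) m2.1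
      have h4 := m1.2.1
      have h5 := m2.2.2
      simp only [ht] at h4 h5
      have h6 : ((q - 1 : ℕ) : ℝ) = q - 1 := by rw [Nat.cast_sub (by omega)]; simp
      rw [Nat.cast_sub h.le]
      rw [h6] at h3
      have h7 : ((q : ℝ) - 1 - p) ≤ 2 * δ / μ := by
        rw [le_div_iff₀ hμ]; linarith
      linarith
  · have hmem : ∀ n, r ≤ n → n < s → n < L ∧ k + δ ≤ t n ∧ t n < k + 1 - δ := fun n h1 h2 => by
      have : n ∈ Finset.Ico r s := Finset.mem_Ico.2 ⟨h1, h2⟩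
      rw [← hrs, Finset.mem_filter, Finset.mem_range] at this
      exact this
    rw [Finset.sum_Ico_eq_sum_range]
    apply norm_sum_expChar_le_of_monotone_diff (fun n => a (r + n)) k δ (s - r) hδ
    · intro n hn
      exact (hmem (r + n) (by omega) (by omega)).2.1
    · intro n hn
      exact (hmem (r + n) (by omega) (by omega)).2.2.le
    · intro n hn
      exact hmono (r + n) (r + n + 1) (by omega) (hmem (r + n + 1) (by omega) (by omega)).1

/-- Discrete second derivative test. -/
theorem norm_sum_expChar_le_of_second_diff (a : ℕ → ℝ) (N : ℕ) (μ M : ℝ) (hμ : 0 < μ) (hM : μ ≤ M)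
    (hlo : ∀ n, n + 2 < N → μ ≤ a (n + 2) - a (n + 1) - (a (n + 1) - a n))
    (hhi : ∀ n, n + 2 < N → a (n + 2) - a (n + 1) - (a (n + 1) - a n) ≤ M) :
    ‖∑ n ∈ Finset.range N, expChar (a n)‖ ≤ 3.3 * (M * N + 2) / √μ := by
  have hsq := Real.sq_sqrt hμ.le
  have hsp := Real.sqrt_pos.2 hμ
  set r := √μ with hr
  have hN0 : (0 : ℝ) ≤ N := Nat.cast_nonneg _
  rcases le_total (1 / 3.3) r with hbig | hsmall
  · refine (norm_sum_expChar_le_card _ _).trans ?_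
    rw [Finset.card_range, le_div_iff₀ hsp]
    have h1 : (N : ℝ) * r ≤ 3.3 * (r ^ 2 * N) := by
      have : (N : ℝ) * r * (1 / 3.3) ≤ N * r * r := by gcongr
      linarith
    have h2 : r ^ 2 * N ≤ M * N := by rw [hsq]; gcongr
    linarith
  rcases Nat.eq_zero_or_pos N with rfl | hN
  · have : 0 < M := by linarith
    simp only [Finset.range_zero, Finset.sum_empty, norm_zero]
    positivity
  -- Only the first `L = N - 1` first differences are controlled; the last term is estimated
  -- separately by `1`.
  obtain ⟨L, rfl⟩ : ∃ L, N = L + 1 := ⟨N - 1, by omega⟩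
  set t : ℕ → ℝ := fun n => a (n + 1) - a n with ht
  have hinc : ∀ i d, i + d < L → t i + d * μ ≤ t (i + d) ∧ t (i + d) ≤ t i + d * M := by
    intro i d
    induction d with
    | zero => intro _; simp
    | succ d ih =>
      intro h
      have h1 := ih (by omega)
      have h2 := hlo (i + d) (by omega)
      have h3 := hhi (i + d) (by omega)
      simp only [ht] at h1 ⊢
      push_cast
      rw [show i + (d + 1) = i + d + 1 by ring]
      rw [show i + d + 1 + 1 = i + d + 2 by ring]
      constructor <;> linarith [h1.1, h1.2]
  have hlow : ∀ i j, i ≤ j → j < L → (a (i + 1) - a i) + (j - i) * μ ≤ a (j + 1) - a j := by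
    intro i j hij hj
    obtain ⟨d, rfl⟩ := Nat.exists_eq_add_of_le hij
    have := (hinc i d hj).1
    push_cast
    simpa using this
  -- Nearly balances `2δ/μ` against `1/δ`, the optimum being `√(μ/2)`.
  set δ := 0.7 * r with hδ
  have hδ0 : 0 < δ := by positivity
  have hblock := fun k => norm_sum_expChar_block_le a L μ δ k hμ hδ0 (by linarith) hlow
  set K := Finset.Icc ⌊t 0 + δ⌋ (⌊t 0 + δ + M * L⌋) with hK
  have hmaps : ∀ n ∈ Finset.range L, ⌊a (n + 1) - a n + δ⌋ ∈ K := by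
    intro n hn
    have h1 := Finset.mem_range.1 hn
    have h2 := hinc 0 n (by omega)
    rw [zero_add] at h2
    simp only [ht, zero_add] at h2
    simp only [hK, Finset.mem_Icc, ht, zero_add]
    have h3 : (n : ℝ) * M ≤ M * L := by
      rw [mul_comm]
      have : (n : ℝ) ≤ L := by exact_mod_cast h1.le
      have : 0 ≤ M := by linarith
      gcongr
    constructor
    · apply Int.floor_le_floor
      have : 0 ≤ (n : ℝ) * μ := by positivity
      linarith
    · apply Int.floor_le_floor
      linarith
  have hcard : (K.card : ℝ) ≤ M * L + 2 := by
    have h0 : ⌊t 0 + δ⌋ ≤ ⌊t 0 + δ + M * L⌋ + 1 := by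
      have : ⌊t 0 + δ⌋ ≤ ⌊t 0 + δ + M * L⌋ := by
        apply Int.floor_le_floor
        have : 0 ≤ M * L := mul_nonneg (by linarith) (Nat.cast_nonneg _)
        linarith
      omega
    have h1 : ((K.card : ℤ) : ℝ) = ((⌊t 0 + δ + M * L⌋ + 1 - ⌊t 0 + δ⌋ : ℤ) : ℝ) := by
      rw [hK, Int.card_Icc_of_le _ _ h0]
    have h2 := Int.floor_le (t 0 + δ + M * L)
    have h3 := Int.lt_floor_add_one (t 0 + δ)
    push_cast at h1
    linarith
  rw [Finset.sum_range_succ]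
  have hone : (1 : ℝ) ≤ (M * (L + 1) + 2) / 2 := by
    have : 0 ≤ M * ((L : ℝ) + 1) := mul_nonneg (by linarith) (by positivity)
    linarith
  have hmain : ‖∑ n ∈ Finset.range L, expChar (a n)‖ ≤ (M * L + 2) * (2 * δ / μ + 1 + 1 / δ) := by
    rw [← Finset.sum_fiberwise_of_maps_to hmaps]
    refine (norm_sum_le _ _).trans ?_
    refine (Finset.sum_le_card_nsmul K _ _ fun k _ => hblock k).trans ?_
    rw [nsmul_eq_mul]
    gcongr
  refine (norm_add_le _ _).trans ?_
  rw [norm_expChar]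
  -- With `r ≤ 1/3.3`, `1.4 + 1/0.7 + 1.5 r < 3.3`. The extra `1/2` pays for the last term.
  have e1 : 2 * δ / μ + 1 + 1 / δ + 1 / 2 ≤ 3.3 / r := by
    rw [← hsq, hδ]
    have e2 : 2 * (0.7 * r) / r ^ 2 + 1 + 1 / (0.7 * r) + 1 / 2 = (1.4 + 1 / 0.7 + 1.5 * r) / r := by
      field_simp
      ring
    rw [e2]
    gcongr
    norm_num at hsmall ⊢
    linarith
  have hX : (0:ℝ) ≤ M * (L + 1) + 2 := by
    linarith
  have hY : (0:ℝ) ≤ 2 * δ / μ + 1 + 1 / δ := by positivity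
  push_cast
  calc ‖∑ n ∈ Finset.range L, expChar (a n)‖ + 1
      ≤ (M * (L + 1) + 2) * (2 * δ / μ + 1 + 1 / δ) + (M * (L + 1) + 2) / 2 := by
        refine add_le_add (hmain.trans ?_) hone
        apply mul_le_mul_of_nonneg_right _ hY
        linarith
    _ = (M * (L + 1) + 2) * (2 * δ / μ + 1 + 1 / δ + 1 / 2) := by ring
    _ ≤ (M * (L + 1) + 2) * (3.3 / r) := by gcongr
    _ = _ := by ring

/-! ### Van der Corput's inequality -/

/-- A distance `h ≥ 1` occurs for `2(H - h) ≤ 2H` pairs; the weight `1 - h/H` is given away. -/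
theorem sum_sum_dist_le (g : ℕ → ℝ) (H : ℕ) (hg : ∀ n, 0 ≤ g n) :
    ∑ i ∈ Finset.range H, ∑ j ∈ Finset.range H, g (((i : ℤ) - j).natAbs) ≤
      H * (g 0 + 2 * ∑ h ∈ Finset.Ico 1 H, g h) := by
  induction H with
  | zero => simp
  | succ H ih =>
    have e1 : ∑ j ∈ Finset.range H, g (((H : ℤ) - j).natAbs) = ∑ h ∈ Finset.Ico 1 (H + 1), g h := by
      rw [Finset.sum_Ico_eq_sum_range, Nat.add_sub_cancel, ← Finset.sum_range_reflect]
      refine Finset.sum_congr rfl fun j hj => ?_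
      have := Finset.mem_range.1 hj
      congr 1
      omega
    have e2 : ∑ i ∈ Finset.range H, g (((i : ℤ) - H).natAbs) = ∑ h ∈ Finset.Ico 1 (H + 1), g h := by
      rw [← e1]
      refine Finset.sum_congr rfl fun j hj => ?_
      congr 1
      omega
    rw [Finset.sum_range_succ, Finset.sum_range_succ]
    simp only [Finset.sum_range_succ _ H, Finset.sum_add_distrib]
    rw [e1, e2, sub_self, Int.natAbs_zero]
    have h3 : ∑ h ∈ Finset.Ico 1 H, g h ≤ ∑ h ∈ Finset.Ico 1 (H + 1), g h :=
      Finset.sum_le_sum_of_subset_of_nonneg (Finset.Ico_subset_Ico le_rfl (by omega))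
        fun i _ _ => hg i
    have h4 : (H : ℝ) * ∑ h ∈ Finset.Ico 1 H, g h ≤ H * ∑ h ∈ Finset.Ico 1 (H + 1), g h := by
      gcongr
    push_cast
    linarith

theorem sum_Ico_shift (F : ℤ → ℂ) (N H j : ℕ) (hj : j ≤ H)
    (hF : ∀ n, n ∉ Finset.Ico (0 : ℤ) N → F n = 0) :
    ∑ m ∈ Finset.Ico (-(H : ℤ)) N, F (m + j) = ∑ n ∈ Finset.Ico (0 : ℤ) N, F n := by
  have h1 : ∑ m ∈ Finset.Ico (-(H : ℤ)) N, F (m + j) =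
      ∑ m ∈ Finset.Ico (-(H : ℤ) + j) (N + j), F m := by
    refine Finset.sum_nbij' (fun m => m + j) (fun m => m - j) ?_ ?_ ?_ ?_ ?_ <;>
      simp
    omega
  rw [h1]
  symm
  apply Finset.sum_subset
  · intro n hn
    simp only [Finset.mem_Ico] at hn ⊢
    omega
  · intro n _ hn
    exact hF n hn

/-- Van der Corput's inequality for a finitely supported function on `ℤ`. -/
theorem vanDerCorput_int (z : ℤ → ℂ) (N H : ℕ)
    (hz : ∀ n, n ∉ Finset.Ico (0 : ℤ) N → z n = 0) :
    (H : ℝ) * ‖∑ n ∈ Finset.Ico (0 : ℤ) N, z n‖ ^ 2 ≤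
      (N + H) * (‖∑ n ∈ Finset.Ico (0 : ℤ) N, z n * (starRingEnd ℂ) (z n)‖ +
        2 * ∑ h ∈ Finset.Ico 1 H,
          ‖∑ n ∈ Finset.Ico (0 : ℤ) N, z (n + h) * (starRingEnd ℂ) (z n)‖) := by
  rcases Nat.eq_zero_or_pos H with rfl | hH
  · simp only [Nat.cast_zero, zero_mul]
    positivity
  set S := ∑ n ∈ Finset.Ico (0 : ℤ) N, z n with hS
  set R : ℕ → ℂ := fun h => ∑ n ∈ Finset.Ico (0 : ℤ) N, z (n + h) * (starRingEnd ℂ) (z n) with hR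
  set w : ℤ → ℂ := fun m => ∑ j ∈ Finset.range H, z (m + j) with hw
  -- The window `[-H, N)` contains every translate of the support by `-j`, so each term of `S` is
  -- counted `H` times. Cauchy–Schwarz over the `N + H` window positions then gives `h3`.
  have h1 : (H : ℂ) * S = ∑ m ∈ Finset.Ico (-(H : ℤ)) N, w m := by
    simp only [hw]
    rw [Finset.sum_comm]
    rw [Finset.sum_congr rfl fun j hj => sum_Ico_shift z N H j (Finset.mem_range.1 hj).le hz]
    simp [hS]
  have hpair : ∀ i j : ℕ, i < H → j < H →
      ‖∑ m ∈ Finset.Ico (-(H : ℤ)) N, z (m + i) * (starRingEnd ℂ) (z (m + j))‖ =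
        ‖R (((i : ℤ) - j).natAbs)‖ := by
    have main : ∀ i j : ℕ, i ≤ j → j < H →
        ∑ m ∈ Finset.Ico (-(H : ℤ)) N, z (m + j) * (starRingEnd ℂ) (z (m + i)) = R (j - i) := by
      intro i j hij hj
      have := sum_Ico_shift (fun n => z (n + (j - i : ℕ)) * (starRingEnd ℂ) (z n)) N H i (by omega)
        (fun n hn => by simp [hz n hn])
      simp only [hR]
      rw [← this]
      refine Finset.sum_congr rfl fun m _ => ?_
      rw [show m + (i : ℤ) + ((j - i : ℕ) : ℤ) = m + j by omega]
    intro i j hi hj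
    rcases le_total i j with h | h
    · rw [show ((i : ℤ) - j).natAbs = j - i by omega, ← main i j h hj, ← Complex.norm_conj, map_sum]
      congr 1
      refine Finset.sum_congr rfl fun m _ => ?_
      simp [mul_comm]
    · rw [show ((i : ℤ) - j).natAbs = i - j by omega, ← main j i h hi]
  have h2 : ∑ m ∈ Finset.Ico (-(H : ℤ)) N, ‖w m‖ ^ 2 ≤
      H * (‖R 0‖ + 2 * ∑ h ∈ Finset.Ico 1 H, ‖R h‖) := by
    refine le_trans ?_ (sum_sum_dist_le (fun h => ‖R h‖) H fun _ => norm_nonneg _)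
    have e : ((∑ m ∈ Finset.Ico (-(H : ℤ)) N, ‖w m‖ ^ 2 : ℝ) : ℂ) =
        ∑ i ∈ Finset.range H, ∑ j ∈ Finset.range H,
          ∑ m ∈ Finset.Ico (-(H : ℤ)) N, z (m + i) * (starRingEnd ℂ) (z (m + j)) := by
      rw [Finset.sum_congr rfl fun i _ => Finset.sum_comm, Finset.sum_comm, Complex.ofReal_sum]
      refine Finset.sum_congr rfl fun m _ => ?_
      rw [Complex.ofReal_pow, ← Complex.mul_conj']
      simp only [hw, map_sum, Finset.sum_mul_sum]
    have e' : ∑ m ∈ Finset.Ico (-(H : ℤ)) N, ‖w m‖ ^ 2 =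
        ‖((∑ m ∈ Finset.Ico (-(H : ℤ)) N, ‖w m‖ ^ 2 : ℝ) : ℂ)‖ := by
      rw [Complex.norm_real, Real.norm_of_nonneg (by positivity)]
    rw [e', e]
    refine (norm_sum_le _ _).trans (Finset.sum_le_sum fun i hi => ?_)
    refine (norm_sum_le _ _).trans (Finset.sum_le_sum fun j hj => ?_)
    exact (hpair i j (Finset.mem_range.1 hi) (Finset.mem_range.1 hj)).le
  have h3 : ((H : ℝ) * ‖S‖) ^ 2 ≤ (N + H) * ∑ m ∈ Finset.Ico (-(H : ℤ)) N, ‖w m‖ ^ 2 := by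
    have e : (H : ℝ) * ‖S‖ = ‖∑ m ∈ Finset.Ico (-(H : ℤ)) N, w m‖ := by
      rw [← h1, norm_mul, Complex.norm_natCast]
    rw [e]
    have hc : ((Finset.Ico (-(H : ℤ)) N).card : ℝ) = N + H := by
      rw [Int.card_Ico, show (N : ℤ) - -(H : ℤ) = ((N + H : ℕ) : ℤ) by push_cast; ring,
        Int.toNat_natCast]
      push_cast
      rfl
    rw [← hc]
    refine (pow_le_pow_left₀ (norm_nonneg _) (norm_sum_le _ _) 2).trans ?_
    exact sq_sum_le_card_mul_sum_sq
  have hHpos : (0 : ℝ) < H := by exact_mod_cast hH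
  have h4 : ((H : ℝ) * ‖S‖) ^ 2 ≤ (N + H) * (H * (‖R 0‖ + 2 * ∑ h ∈ Finset.Ico 1 H, ‖R h‖)) :=
    h3.trans (by gcongr)
  have e0 : R 0 = ∑ n ∈ Finset.Ico (0 : ℤ) N, z n * (starRingEnd ℂ) (z n) := by
    simp [hR]
  rw [← e0]
  refine le_of_mul_le_mul_left ?_ hHpos
  linarith

/-- The sum obtained from `∑ e(a n)` over `[0, N)` by one Weyl–van der Corput step. -/
theorem norm_sum_expChar_sq_le (a : ℕ → ℝ) (N H : ℕ) :
    (H : ℝ) * ‖∑ n ∈ Finset.range N, expChar (a n)‖ ^ 2 ≤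
      (N + H) * (N + 2 * ∑ h ∈ Finset.Ico 1 H,
          ‖∑ n ∈ Finset.range (N - h), expChar (a (n + h) - a n)‖) := by
  -- Extension by zero makes the correlation at shift `h` a sum over the `N - h` indices with `n + h
  -- < N`.
  set z : ℤ → ℂ := fun n => if n ∈ Finset.Ico (0 : ℤ) N then expChar (a n.toNat) else 0 with hzdef
  have hz : ∀ n, n ∉ Finset.Ico (0 : ℤ) N → z n = 0 := fun n hn => if_neg hn
  have hz' : ∀ n : ℕ, n < N → z n = expChar (a n) := fun n hn => by
    simp only [hzdef]
    rw [if_pos (by rw [Finset.mem_Ico]; omega), Int.toNat_natCast]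
  have hcast : ∀ F : ℤ → ℂ, ∑ n ∈ Finset.Ico (0 : ℤ) N, F n = ∑ n ∈ Finset.range N, F n := by
    intro F
    refine (Finset.sum_nbij' (fun n : ℕ => (n : ℤ)) (fun n => n.toNat) ?_ ?_ ?_ ?_ ?_).symm
    · intro n hn; simp at hn ⊢; omega
    · intro n hn; simp at hn ⊢; omega
    · intro n hn; simp
    · intro n hn; simp at hn ⊢; omega
    · intro n hn; rfl
  have h := vanDerCorput_int z N H hz
  have e1 : ∑ n ∈ Finset.Ico (0 : ℤ) N, z n = ∑ n ∈ Finset.range N, expChar (a n) := by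
    rw [hcast]
    exact Finset.sum_congr rfl fun n hn => hz' n (Finset.mem_range.1 hn)
  have e2 : ‖∑ n ∈ Finset.Ico (0 : ℤ) N, z n * (starRingEnd ℂ) (z n)‖ = N := by
    rw [hcast, Finset.sum_congr rfl fun n hn => by
      rw [hz' n (Finset.mem_range.1 hn), Complex.mul_conj', norm_expChar]]
    simp
  have e3 : ∀ h : ℕ, ∑ n ∈ Finset.Ico (0 : ℤ) N, z (n + h) * (starRingEnd ℂ) (z n) =
      ∑ n ∈ Finset.range (N - h), expChar (a (n + h) - a n) := by
    intro h
    rw [hcast]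
    symm
    have hsub : Finset.range (N - h) ⊆ Finset.range N := Finset.range_subset_range.2 (by omega)
    rw [← Finset.sum_subset hsub]
    · refine Finset.sum_congr rfl fun n hn => ?_
      have := Finset.mem_range.1 hn
      rw [expChar_sub, hz' n (by omega)]
      have := hz' (n + h) (by omega)
      push_cast at this
      rw [this]
    · intro n _ hn
      rw [hz (n + h), zero_mul]
      simp only [Finset.mem_Ico, Finset.mem_range] at hn ⊢
      omega
  rw [e1, e2] at h
  simp only [e3] at h
  exact h

/-! ### Forward differences of the shifted sequence -/

/-- Telescoping `a(i+h) - a(i)` into `h` first differences trades one order of difference for a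
factor `h` in the bounds. -/
theorem fwdDiff_iter_sub_shift (a : ℕ → ℝ) (k h n : ℕ) :
    (fwdDiff 1)^[k] (fun i => a (i + h) - a i) n =
      ∑ j ∈ Finset.range h, (fwdDiff 1)^[k + 1] a (n + j) := by
  have e : (fun i => a (i + h) - a i) = ∑ j ∈ Finset.range h, fun i => fwdDiff 1 a (i + j) := by
    funext i
    rw [Finset.sum_apply]
    have := Finset.sum_range_sub (fun j => a (i + j)) h
    simp only [add_zero] at this
    rw [← this]
    rfl
  rw [e, fwdDiff_iter_finsetSum, Finset.sum_apply]
  refine Finset.sum_congr rfl fun j _ => ?_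
  rw [fwdDiff_iter_comp_add, Function.iterate_succ_apply]

theorem fwdDiff_iter_sub_shift_bounds (a : ℕ → ℝ) (k h N : ℕ) (l L : ℝ)
    (ha : ∀ n, n + (k + 1) < N → l ≤ (fwdDiff 1)^[k + 1] a n ∧ (fwdDiff 1)^[k + 1] a n ≤ L)
    (n : ℕ) (hn : n + k < N - h) :
    h * l ≤ (fwdDiff 1)^[k] (fun i => a (i + h) - a i) n ∧
      (fwdDiff 1)^[k] (fun i => a (i + h) - a i) n ≤ h * L := by
  rw [fwdDiff_iter_sub_shift]
  have hb : ∀ j ∈ Finset.range h, n + j + (k + 1) < N := fun j hj => by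
    have := Finset.mem_range.1 hj
    omega
  constructor
  · simpa using Finset.card_nsmul_le_sum (Finset.range h) _ l fun j hj => (ha _ (hb j hj)).1
  · simpa using Finset.sum_le_card_nsmul (Finset.range h) _ L fun j hj => (ha _ (hb j hj)).2

/-! ### Power sums over the shifts -/

theorem sum_Ico_sqrt_le (H : ℕ) : ∑ h ∈ Finset.Ico 1 H, √(h : ℝ) ≤ 2 / 3 * (H * √H) := by
  induction H with
  | zero => simp
  | succ H ih =>
    rcases Nat.eq_zero_or_pos H with rfl | hH
    · norm_num
    rw [Finset.sum_Ico_succ_top (by omega)]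
    push_cast
    have h1 := Real.sq_sqrt (Nat.cast_nonneg (α := ℝ) H)
    have h2 := Real.sq_sqrt (x := (H : ℝ) + 1) (by positivity)
    have h3 := Real.sqrt_nonneg (H : ℝ)
    have h4 : √(H : ℝ) ≤ √((H : ℝ) + 1) := Real.sqrt_le_sqrt (by linarith)
    have h5 : 0 < √((H : ℝ) + 1) := by positivity
    generalize √(H : ℝ) = x at *
    generalize √((H : ℝ) + 1) = y at *
    rw [← h1] at ih ⊢
    have h6 : y ^ 2 - x ^ 2 = 1 := by rw [h1, h2]; ring
    have h8 : x ≤ 2 / 3 * (y ^ 3 - x ^ 3) := by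
      have e : y ^ 3 - x ^ 3 - 3 / 2 * x = (y - x) * ((y - x) * (2 * y + x)) / 2 := by
        linear_combination (3 / 2 * x) * h6
      have : 0 ≤ (y - x) * ((y - x) * (2 * y + x)) := by
        have : 0 ≤ y - x := by linarith
        positivity
      linarith
    have h9 : x ^ 2 + 1 = y ^ 2 := by linarith
    rw [h9]
    linarith

theorem sum_Ico_rpow_neg_le {s : ℝ} (hs0 : 0 ≤ s) (hs1 : s < 1) (H : ℕ) :
    ∑ h ∈ Finset.Ico 1 (H + 1), (h : ℝ) ^ (-s) ≤ (H : ℝ) ^ (1 - s) / (1 - s) := by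
  have hs : 0 < 1 - s := by linarith
  induction H with
  | zero => simp [Real.zero_rpow hs.ne']
  | succ H ih =>
    rw [Finset.sum_Ico_succ_top (by omega)]
    have hp : (0 : ℝ) < (H + 1 : ℕ) := by positivity
    set x : ℝ := ((H + 1 : ℕ) : ℝ) with hx
    have hx1 : (1 : ℝ) ≤ x := by rw [hx]; push_cast; linarith [Nat.cast_nonneg (α := ℝ) H]
    have hH : (H : ℝ) = x * (1 + -(1 / x)) := by
      rw [hx]
      push_cast
      field_simp
      ring
    have hinv : 1 / x ≤ 1 := by rw [div_le_one hp]; exact hx1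
    -- Bernoulli's inequality for an exponent in `[0, 1]` replaces the comparison with an integral.
    have hb := rpow_one_add_le_one_add_mul_self (s := -(1 / x)) (by linarith) hs.le
      (by linarith : 1 - s ≤ 1)
    have h1 : (H : ℝ) ^ (1 - s) ≤ x ^ (1 - s) - (1 - s) * x ^ (-s) := by
      rw [hH, Real.mul_rpow hp.le (by linarith)]
      have e : x ^ (-s) = x ^ (1 - s) / x := by
        rw [← Real.rpow_sub_one hp.ne']; congr 1; ring
      rw [e]
      refine (mul_le_mul_of_nonneg_left hb (Real.rpow_nonneg hp.le _)).trans (le_of_eq ?_)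
      ring
    have h2 : (H : ℝ) ^ (1 - s) / (1 - s) ≤ x ^ (1 - s) / (1 - s) - x ^ (-s) := by
      rw [div_le_iff₀ hs, sub_mul, div_mul_cancel₀ _ hs.ne']
      linarith
    linarith

theorem sum_Ico_div_rpow_le {s : ℝ} (hs0 : 0 ≤ s) (hs1 : s < 1) (H : ℕ) :
    ∑ h ∈ Finset.Ico 1 H, ((H : ℝ) / h) ^ s ≤ H / (1 - s) := by
  have hs : 0 < 1 - s := by linarith
  rcases Nat.eq_zero_or_pos H with rfl | hH
  · simp
  have hp : (0 : ℝ) < H := by exact_mod_cast hH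
  have h1 : ∑ h ∈ Finset.Ico 1 H, ((H : ℝ) / h) ^ s =
      (H : ℝ) ^ s * ∑ h ∈ Finset.Ico 1 H, (h : ℝ) ^ (-s) := by
    rw [Finset.mul_sum]
    refine Finset.sum_congr rfl fun h hh => ?_
    rw [Real.div_rpow hp.le (Nat.cast_nonneg _), Real.rpow_neg (Nat.cast_nonneg _), div_eq_mul_inv]
  have h2 : ∑ h ∈ Finset.Ico 1 H, (h : ℝ) ^ (-s) ≤ ∑ h ∈ Finset.Ico 1 (H + 1), (h : ℝ) ^ (-s) :=
    Finset.sum_le_sum_of_subset_of_nonneg (Finset.Ico_subset_Ico le_rfl (by omega))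
      fun i _ _ => by positivity
  rw [h1]
  calc _ ≤ (H : ℝ) ^ s * ((H : ℝ) ^ (1 - s) / (1 - s)) := by
        gcongr
        exact h2.trans (sum_Ico_rpow_neg_le hs0 hs1 H)
    _ = (H : ℝ) ^ (s + (1 - s)) / (1 - s) := by rw [Real.rpow_add hp]; ring
    _ = _ := by rw [add_sub_cancel, Real.rpow_one]

/-! ### Induction on the order -/

/-- The bound of the `(k + 1)`-st derivative test for sequences of at most `N` terms. The three
hypotheses on `m` say that `m` is at least each of the three terms of the maximum. -/
def DerivTestBound (k : ℕ) : Prop :=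
  ∀ (N N' : ℕ) (a : ℕ → ℝ) (l L m : ℝ), N' ≤ N → 0 < l → l ≤ L → 0 < m →
    (∀ n, n + (k + 1) < N' →
      l ≤ (fwdDiff 1)^[k + 1] a n ∧ (fwdDiff 1)^[k + 1] a n ≤ L) →
    L ≤ l * N * (m / 7.4) ^ 2 ^ k →
    L ^ 2 * (m / 5.75) ^ 2 ≤ l * ((m / 5.75) ^ 2 ^ k) ^ 2 →
    1 ≤ l * N ^ (k + 1) * (m / 10.8) ^ 2 ^ k →
    ‖∑ n ∈ Finset.range N', expChar (a n)‖ ≤ m * N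

theorem norm_sum_expChar_le_of_one_le {N N' : ℕ} (a : ℕ → ℝ) {m : ℝ} (h : N' ≤ N) (hm : 1 ≤ m) :
    ‖∑ n ∈ Finset.range N', expChar (a n)‖ ≤ m * N := by
  refine (norm_sum_expChar_le_card _ _).trans ?_
  rw [Finset.card_range]
  have h1 : (N' : ℝ) ≤ N := by exact_mod_cast h
  have h2 : (0 : ℝ) ≤ N := Nat.cast_nonneg _
  nlinarith

/-- One Weyl–van der Corput step, given a bound for the differenced sums. -/
theorem norm_sum_expChar_le_of_differenced (a : ℕ → ℝ) (N N' H : ℕ) (m : ℝ) (b : ℕ → ℝ)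
    (hN : N' ≤ N) (hH1 : 1 ≤ H) (hHN : H ≤ N) (hm : 0 ≤ m)
    (hb : ∀ h, 1 ≤ h → h < H →
      ‖∑ n ∈ Finset.range (N' - h), expChar (a (n + h) - a n)‖ ≤ b h * N)
    (hsum : 2 * (1 + 2 * ∑ h ∈ Finset.Ico 1 H, b h) ≤ H * m ^ 2) :
    ‖∑ n ∈ Finset.range N', expChar (a n)‖ ≤ m * N := by
  have h1 := norm_sum_expChar_sq_le a N' H
  have hNr : (N' : ℝ) ≤ N := by exact_mod_cast hN
  have hHr : (H : ℝ) ≤ N := by exact_mod_cast hHN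
  have hHp : (0 : ℝ) < H := by exact_mod_cast hH1
  have hNp : (0 : ℝ) ≤ N := Nat.cast_nonneg _
  have h2 : ∑ h ∈ Finset.Ico 1 H, ‖∑ n ∈ Finset.range (N' - h), expChar (a (n + h) - a n)‖ ≤
      (∑ h ∈ Finset.Ico 1 H, b h) * N := by
    rw [Finset.sum_mul]
    refine Finset.sum_le_sum fun h hh => ?_
    rw [Finset.mem_Ico] at hh
    exact hb h hh.1 hh.2
  -- `N' + H ≤ 2N` is the source of the outer factor `2` in `hsum`.
  have h3 : (N' + H : ℝ) * (N' + 2 * ∑ h ∈ Finset.Ico 1 H,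
      ‖∑ n ∈ Finset.range (N' - h), expChar (a (n + h) - a n)‖) ≤
        (N + N) * (N + 2 * ((∑ h ∈ Finset.Ico 1 H, b h) * N)) := by
    gcongr
  have h4 : (N + N : ℝ) * (N + 2 * ((∑ h ∈ Finset.Ico 1 H, b h) * N)) ≤ H * (m * N) ^ 2 := by
    calc _ = (N : ℝ) ^ 2 * (2 * (1 + 2 * ∑ h ∈ Finset.Ico 1 H, b h)) := by ring
      _ ≤ (N : ℝ) ^ 2 * (H * m ^ 2) := by gcongr
      _ = _ := by ring
  have h5 := le_of_mul_le_mul_left ((h1.trans h3).trans h4) hHp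
  exact (pow_le_pow_iff_left₀ (norm_nonneg _) (by positivity) two_ne_zero).1 h5

/-- `H` must be large for the diagonal term and the `h^(-1/2)` terms, yet small for the `√h` terms
and at most `N`. Each of the two lower bounds is compatible with each upper bound by one of the
hypotheses on `m`. Since `x ≥ 20`, rounding up costs at most a factor `1.05`. -/
theorem exists_shift_third {N : ℕ} {l L m : ℝ} (hl : 0 < l) (hL : l ≤ L) (hm : 0 < m) (hm1 : m < 1)
    (h1 : L ≤ l * N * (m / 7.4) ^ 4) (h2 : L ^ 2 * (m / 5.75) ^ 2 ≤ l * ((m / 5.75) ^ 4) ^ 2)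
    (h3 : 1 ≤ l * N ^ 3 * (m / 10.8) ^ 4) :
    ∃ H : ℕ, 1 ≤ H ∧ H ≤ N ∧ 20 ≤ H * m ^ 2 ∧ 640 * L ^ 2 * H ≤ m ^ 4 * l ∧
      11152 ≤ m ^ 4 * N ^ 2 * l * H := by
  have hL0 : 0 < L := by linarith
  have hN : (0 : ℝ) < N := by
    rcases Nat.eq_zero_or_pos N with rfl | h
    · simp at h1; linarith
    · exact_mod_cast h
  have hm2 : m ^ 2 ≤ 1 := by nlinarith
  have hm4 : m ^ 4 ≤ m ^ 2 := by nlinarith [sq_nonneg m]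
  have hmp2 : 0 < m ^ 2 := by positivity
  have hNm : 20 ≤ N * m ^ 2 := by
    have e : l * 1 ≤ l * (N * (m / 7.4) ^ 4) := by linarith
    have e2 := le_of_mul_le_mul_left e hl
    have e3 : (m / 7.4) ^ 4 ≤ m ^ 2 / 20 := by
      rw [div_pow, div_le_div_iff₀ (by norm_num) (by norm_num)]
      have : (20:ℝ) ≤ 7.4 ^ 4 := by norm_num
      nlinarith
    have := mul_le_mul_of_nonneg_left e3 hN.le
    linarith
  set x := max (20 / m ^ 2) (11152 / (m ^ 4 * N ^ 2 * l)) with hx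
  have hx1 : 20 / m ^ 2 ≤ x := le_max_left _ _
  have hx2 : 11152 / (m ^ 4 * N ^ 2 * l) ≤ x := le_max_right _ _
  have hx20 : 20 ≤ x := le_trans (by rw [le_div_iff₀ hmp2]; linarith) hx1
  have hc := Nat.le_ceil x
  have hc' : (⌈x⌉₊ : ℝ) ≤ 1.05 * x := by
    have := Nat.ceil_lt_add_one (show 0 ≤ x by linarith)
    linarith
  have hden : 0 < m ^ 4 * N ^ 2 * l := by positivity
  refine ⟨⌈x⌉₊, ?_, ?_, ?_, ?_, ?_⟩
  · rw [Nat.one_le_ceil_iff]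
    linarith
  · rw [Nat.ceil_le]
    apply max_le
    · rw [div_le_iff₀ hmp2]; exact hNm
    · rw [div_le_iff₀ hden]
      have e : (m / 10.8) ^ 4 = m ^ 4 / 10.8 ^ 4 := by ring
      rw [e, mul_div_assoc', le_div_iff₀ (by norm_num)] at h3
      have : (11152 : ℝ) ≤ 1 * 10.8 ^ 4 := by norm_num
      nlinarith
  · have := (div_le_iff₀ hmp2).1 (hx1.trans hc)
    exact this
  · have key : 640 * L ^ 2 * (1.05 * x) ≤ m ^ 4 * l := by
      have hk : 640 * L ^ 2 * 1.05 * x ≤ m ^ 4 * l := by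
        rw [hx, mul_max_of_nonneg _ _ (by positivity)]
        apply max_le
        · rw [mul_div_assoc', div_le_iff₀ hmp2]
          have e : L ^ 2 * (m / 5.75) ^ 2 * 5.75 ^ 8 ≤ l * ((m / 5.75) ^ 4) ^ 2 * 5.75 ^ 8 := by
            gcongr
          have e1 : L ^ 2 * (m / 5.75) ^ 2 * 5.75 ^ 8 = m ^ 2 * (L ^ 2 * 5.75 ^ 6) := by ring
          have e2 : l * ((m / 5.75) ^ 4) ^ 2 * 5.75 ^ 8 = m ^ 2 * (l * m ^ 6) := by ring
          rw [e1, e2] at e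
          have e3 := le_of_mul_le_mul_left e hmp2
          have e4 : L ^ 2 * (640 * 1.05 * 20) ≤ L ^ 2 * 5.75 ^ 6 := by
            gcongr; norm_num
          linarith
        · rw [mul_div_assoc', div_le_iff₀ hden]
          have e : L ^ 2 ≤ (l * N * (m / 7.4) ^ 4) ^ 2 := by gcongr
          have e1 : (l * N * (m / 7.4) ^ 4) ^ 2 * 7.4 ^ 8 = m ^ 4 * l * (m ^ 4 * N ^ 2 * l) := by
            ring
          have e2 : L ^ 2 * (640 * 1.05 * 11152) ≤ L ^ 2 * 7.4 ^ 8 := by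
            gcongr; norm_num
          have e3 : L ^ 2 * 7.4 ^ 8 ≤ (l * N * (m / 7.4) ^ 4) ^ 2 * 7.4 ^ 8 := by gcongr
          linarith
      linarith
    refine le_trans ?_ key
    gcongr
  · have := (div_le_iff₀ hden).1 (hx2.trans hc)
    linarith

theorem derivTestBound_two : DerivTestBound 2 := by
  intro N N' a l L m hN hl hL hm ha h1 h2 h3
  norm_num only at h1 h2 h3
  rcases le_or_gt 1 m with hm1 | hm1
  · exact norm_sum_expChar_le_of_one_le a hN hm1
  obtain ⟨H, hH1, hHN, hHa, hHb, hHc⟩ := exists_shift_third (N := N) (L := L) hl hL hm hm1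
    (by convert h1 using 3; norm_num)
    (by convert h2 using 4 <;> norm_num) (by convert h3 using 3; norm_num)
  have hL0 : 0 < L := by linarith
  have hHp : (0 : ℝ) < H := by exact_mod_cast hH1
  have hNp : (0 : ℝ) < N := by exact_mod_cast (by omega : 0 < N)
  set s := √l with hs
  have hsl : s ^ 2 = l := Real.sq_sqrt hl.le
  have hsp : 0 < s := Real.sqrt_pos.2 hl
  set r := √(H : ℝ) with hr
  have hrH : r ^ 2 = H := Real.sq_sqrt hHp.le
  have hrp : 0 < r := Real.sqrt_pos.2 hHp
  have hq : 25.2 * (L * r) ≤ m ^ 2 * s := by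
    refine (pow_le_pow_iff_left₀ (by positivity) (by positivity) two_ne_zero).1 ?_
    calc (25.2 * (L * r)) ^ 2 = 25.2 ^ 2 * L ^ 2 * r ^ 2 := by ring
      _ ≤ 640 * L ^ 2 * H := by rw [hrH]; gcongr; norm_num
      _ ≤ m ^ 4 * l := hHb
      _ = _ := by rw [← hsl]; ring
  have ht : 105.6 ≤ m ^ 2 * N * s * r := by
    refine (pow_le_pow_iff_left₀ (by positivity) (by positivity) two_ne_zero).1 ?_
    calc (105.6 : ℝ) ^ 2 ≤ 11152 := by norm_num
      _ ≤ m ^ 4 * N ^ 2 * l * H := hHc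
      _ = _ := by rw [← hsl, ← hrH]; ring
  -- The second derivative test with `h l`, `h L` and length at most `N`, divided by `N` and split
  -- by powers of `h`.
  refine norm_sum_expChar_le_of_differenced a N N' H m
    (fun h => 3.3 * (L / s) * √(h : ℝ) + 6.6 / (N * s) * ((h : ℝ) ^ (-(1 / 2 : ℝ)))) hN hH1 hHN hm.le
    ?_ ?_
  · intro h hh1 hhH
    have hhp : (0 : ℝ) < h := by exact_mod_cast hh1
    have hd := fwdDiff_iter_sub_shift_bounds a 2 h N' l L ha
    have hform : ∀ n, (fwdDiff 1)^[2] (fun i => a (i + h) - a i) n =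
        (a (n + 2 + h) - a (n + 2)) - (a (n + 1 + h) - a (n + 1)) -
          ((a (n + 1 + h) - a (n + 1)) - (a (n + h) - a n)) := fun n => rfl
    have h5 := norm_sum_expChar_le_of_second_diff (fun i => a (i + h) - a i) (N' - h) (h * l) (h * L)
      (by positivity) (by gcongr) (fun n hn => (hform n) ▸ (hd n hn).1)
      (fun n hn => (hform n) ▸ (hd n hn).2)
    refine h5.trans ?_
    have hsq : √((h : ℝ) * l) = √(h : ℝ) * s := Real.sqrt_mul hhp.le _
    have hu : √(h : ℝ) ^ 2 = h := Real.sq_sqrt hhp.le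
    have hup : 0 < √(h : ℝ) := Real.sqrt_pos.2 hhp
    have hpow : (h : ℝ) ^ (-(1 / 2 : ℝ)) = 1 / √(h : ℝ) := by
      rw [Real.rpow_neg hhp.le, ← Real.sqrt_eq_rpow, one_div]
    rw [hsq, hpow]
    have hsub : ((N' - h : ℕ) : ℝ) ≤ N := by exact_mod_cast (by omega : N' - h ≤ N)
    calc _ ≤ 3.3 * (h * L * N + 2) / (√(h : ℝ) * s) := by gcongr
      _ = _ := by
        nth_rewrite 1 [← hu]
        field_simp
        ring
  · have e1 := sum_Ico_sqrt_le H
    have e2 : ∑ h ∈ Finset.Ico 1 H, (h : ℝ) ^ (-(1 / 2 : ℝ)) ≤ 2 * r := by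
      have e3 : ∑ h ∈ Finset.Ico 1 H, (h : ℝ) ^ (-(1 / 2 : ℝ)) ≤
          ∑ h ∈ Finset.Ico 1 (H + 1), (h : ℝ) ^ (-(1 / 2 : ℝ)) :=
        Finset.sum_le_sum_of_subset_of_nonneg (Finset.Ico_subset_Ico le_rfl (by omega))
          fun i _ _ => by positivity
      have e4 := sum_Ico_rpow_neg_le (s := 1 / 2) (by norm_num) (by norm_num) H
      rw [show (1 : ℝ) - 1 / 2 = 1 / 2 by norm_num, ← Real.sqrt_eq_rpow] at e4
      linarith
    rw [← hr] at e1
    rw [Finset.sum_add_distrib, ← Finset.mul_sum, ← Finset.mul_sum]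
    have f1 : 3.3 * (L / s) * ∑ h ∈ Finset.Ico 1 H, √(h : ℝ) ≤ 2.2 / 25.2 * (H * m ^ 2) := by
      calc _ ≤ 3.3 * (L / s) * (2 / 3 * (H * r)) := by gcongr
        _ = 2.2 / 25.2 * (H * ((25.2 * (L * r)) / s)) := by ring
        _ ≤ 2.2 / 25.2 * (H * m ^ 2) := by
          gcongr
          rwa [div_le_iff₀ hsp]
    have f2 : 6.6 / (N * s) * ∑ h ∈ Finset.Ico 1 H, (h : ℝ) ^ (-(1 / 2 : ℝ)) ≤
        13.2 / 105.6 * (H * m ^ 2) := by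
      calc _ ≤ 6.6 / (N * s) * (2 * r) := by gcongr
        _ = 13.2 / 105.6 * (105.6 * (r / (N * s))) := by ring
        _ ≤ 13.2 / 105.6 * ((m ^ 2 * N * s * r) * (r / (N * s))) := by gcongr
        _ = 13.2 / 105.6 * (r ^ 2 * m ^ 2) := by field_simp
        _ = _ := by rw [hrH]
    norm_num at f1 f2 hHa ⊢
    linarith

/-- The default `⌊(5.75/m)²⌋` is the largest shift for which the upper bound follows directly from
`h2`. If it is too short for the last condition, the least sufficient shift `⌈1/P⌉` is taken; the
upper bound then comes from `h1`, and `H ≤ N` from `h3`. -/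
theorem exists_shift_step {k N : ℕ} {l L m : ℝ} (hk : 2 ≤ k) (hl : 0 < l) (hL : l ≤ L) (hm : 0 < m)
    (hm1 : m < 1) (h1 : L ≤ l * N * ((m / 7.4) ^ 2 ^ k) ^ 2)
    (h2 : L ^ 2 * (m / 5.75) ^ 2 ≤ l * (((m / 5.75) ^ 2 ^ k) ^ 2) ^ 2)
    (h3 : 1 ≤ l * N ^ (k + 2) * ((m / 10.8) ^ 2 ^ k) ^ 2) :
    ∃ H : ℕ, 1 ≤ H ∧ H ≤ N ∧ 32 ≤ H * m ^ 2 ∧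
      H * L ^ 2 * (m / 5.75) ^ 4 ≤ l * (((m / 5.75) ^ 2 ^ k) ^ 2) ^ 2 ∧
      1 ≤ H * l * N ^ (k + 1) * (m ^ 2 / (5.75 * 10.8)) ^ 2 ^ k := by
  have hL0 : 0 < L := by linarith
  have hNn : 1 ≤ N := by
    rcases Nat.eq_zero_or_pos N with rfl | h
    · simp at h1; linarith
    · exact h
  have hN : (0 : ℝ) < N := by exact_mod_cast hNn
  have hm2 : m ^ 2 < 1 := by nlinarith
  set E := 2 ^ k with hE
  have hE4 : 4 ≤ E := by
    calc 4 = 2 ^ 2 := rfl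
      _ ≤ 2 ^ k := Nat.pow_le_pow_right (by norm_num) hk
  have hNx : 1 ≤ N * ((m / 7.4) ^ E) ^ 2 := by
    have e : l * 1 ≤ l * (N * ((m / 7.4) ^ E) ^ 2) := by linarith
    exact le_of_mul_le_mul_left e hl
  have hx0 : 0 < m / 7.4 := by positivity
  have hx1 : m / 7.4 ≤ 1 := by rw [div_le_one (by norm_num)]; norm_num; linarith
  have hBsq : 0 < (5.75 / m) ^ 2 := by positivity
  have hBN : (5.75 / m) ^ 2 ≤ N := by
    have e : (m / 7.4) ^ E ≤ m / 7.4 := pow_le_of_le_one hx0.le hx1 (by omega)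
    have e2 : ((m / 7.4) ^ E) ^ 2 ≤ (m / 5.75) ^ 2 := by
      gcongr
      refine e.trans ?_
      gcongr
      norm_num
    have e3 : 1 ≤ N * (m / 5.75) ^ 2 := hNx.trans (by gcongr)
    rw [div_pow, div_le_iff₀ (by positivity)]
    rw [div_pow, mul_div_assoc', le_div_iff₀ (by norm_num)] at e3
    linarith
  set H0 := ⌊(5.75 / m) ^ 2⌋₊ with hH0
  have hH0a : (H0 : ℝ) ≤ (5.75 / m) ^ 2 := Nat.floor_le hBsq.le
  have hH0b : 32 ≤ H0 * m ^ 2 := by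
    have e := Nat.lt_floor_add_one ((5.75 / m) ^ 2)
    rw [← hH0, div_pow, div_lt_iff₀ (by positivity)] at e
    norm_num at e ⊢
    linarith
  have hH0c : 1 ≤ H0 := by
    by_contra h
    have : H0 = 0 := by omega
    rw [this] at hH0b
    norm_num at hH0b
  have hp : 0 < l * N ^ (k + 1) * (m ^ 2 / (5.75 * 10.8)) ^ E := by positivity
  rcases le_or_gt 1 (H0 * (l * N ^ (k + 1) * (m ^ 2 / (5.75 * 10.8)) ^ E)) with hcase | hcase
  · refine ⟨H0, hH0c, ?_, hH0b, ?_, by linarith⟩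
    · exact_mod_cast hH0a.trans hBN
    · refine le_trans ?_ h2
      have : (H0 : ℝ) * (m / 5.75) ^ 2 ≤ 1 := by
        calc _ ≤ (5.75 / m) ^ 2 * (m / 5.75) ^ 2 := by gcongr
          _ = 1 := by field_simp
      calc _ = L ^ 2 * (m / 5.75) ^ 2 * (H0 * (m / 5.75) ^ 2) := by ring
        _ ≤ L ^ 2 * (m / 5.75) ^ 2 * 1 := by gcongr
        _ = _ := mul_one _
  set P := l * N ^ (k + 1) * (m ^ 2 / (5.75 * 10.8)) ^ E with hP
  have hx : (H0 : ℝ) < 1 / P := by rwa [lt_div_iff₀ hp]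
  have hc := Nat.le_ceil (1 / P)
  have hH0r : (1 : ℝ) ≤ H0 := by exact_mod_cast hH0c
  have hc' : (⌈1 / P⌉₊ : ℝ) ≤ 2 / P := by
    have := Nat.ceil_lt_add_one (show 0 ≤ 1 / P by positivity)
    have e : 2 / P = 1 / P + 1 / P := by ring
    linarith
  refine ⟨⌈1 / P⌉₊, ?_, ?_, ?_, ?_, ?_⟩
  · rw [Nat.one_le_ceil_iff]; positivity
  · rw [Nat.ceil_le, div_le_iff₀ hp]
    refine h3.trans ?_
    rw [← pow_mul, mul_comm E 2, pow_mul]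
    calc _ = N * (l * N ^ (k + 1) * ((m / 10.8) ^ 2) ^ E) := by ring
      _ ≤ N * (l * N ^ (k + 1) * (m ^ 2 / (5.75 * 10.8)) ^ E) := by
        gcongr
        rw [div_pow]
        gcongr
        norm_num
  · refine hH0b.trans ?_
    gcongr
    exact_mod_cast hx.le.trans hc
  -- `h1` enters twice through `L²` and once more through its consequence `hNx`, giving `N³ ≤
  -- N^(k+1)` room as `k ≥ 2`. The constants fit because `5.75⁵ · 10.8 ≤ 7.4⁶`.
  · have hkey : 2 * L ^ 2 * (m / 5.75) ^ 4 ≤ l * (((m / 5.75) ^ E) ^ 2) ^ 2 * P := by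
      have a1 : L ^ 2 ≤ (l * N * ((m / 7.4) ^ E) ^ 2) ^ 2 := by gcongr
      have a2 : 2 * (m / 5.75) ^ 4 ≤ 1 := by
        have : (m / 5.75) ^ 4 ≤ (1 / 5.75) ^ 4 := by gcongr
        have e : (1 / 5.75 : ℝ) ^ 4 ≤ 1 / 2 := by norm_num
        linarith
      have a3 : (N : ℝ) ^ 3 ≤ N ^ (k + 1) :=
        pow_le_pow_right₀ (by exact_mod_cast hNn) (by omega)
      have a4 : (((m / 7.4) ^ E) ^ 2) ^ 3 ≤
          (((m / 5.75) ^ E) ^ 2) ^ 2 * (m ^ 2 / (5.75 * 10.8)) ^ E := by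
        have b1 : (((m / 7.4) ^ E) ^ 2) ^ 3 = ((m / 7.4) ^ 6) ^ E := by
          rw [← pow_mul, ← pow_mul, ← pow_mul]; congr 1; ring
        have b2 : (((m / 5.75) ^ E) ^ 2) ^ 2 = ((m / 5.75) ^ 4) ^ E := by
          rw [← pow_mul, ← pow_mul, ← pow_mul]; congr 1; ring
        rw [b1, b2, ← mul_pow]
        gcongr
        have b3 : (m / 7.4) ^ 6 = m ^ 6 * (1 / 7.4 ^ 6) := by ring
        have b4 : (m / 5.75) ^ 4 * (m ^ 2 / (5.75 * 10.8)) = m ^ 6 * (1 / (5.75 ^ 5 * 10.8)) := by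
          ring
        rw [b3, b4]
        gcongr
        norm_num
      calc 2 * L ^ 2 * (m / 5.75) ^ 4 = L ^ 2 * (2 * (m / 5.75) ^ 4) := by ring
        _ ≤ (l * N * ((m / 7.4) ^ E) ^ 2) ^ 2 * 1 := by gcongr
        _ ≤ (l * N * ((m / 7.4) ^ E) ^ 2) ^ 2 * (N * ((m / 7.4) ^ E) ^ 2) := by gcongr
        _ = l ^ 2 * (N : ℝ) ^ 3 * (((m / 7.4) ^ E) ^ 2) ^ 3 := by ring
        _ ≤ l ^ 2 * (N : ℝ) ^ (k + 1) *
            ((((m / 5.75) ^ E) ^ 2) ^ 2 * (m ^ 2 / (5.75 * 10.8)) ^ E) := by gcongr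
        _ = _ := by rw [hP]; ring
    calc _ ≤ 2 / P * L ^ 2 * (m / 5.75) ^ 4 := by gcongr
      _ = 2 * L ^ 2 * (m / 5.75) ^ 4 / P := by ring
      _ ≤ _ := by rwa [div_le_iff₀ hp]
  · exact ((div_le_iff₀ hp).1 hc).trans_eq (by rw [hP]; ring)

theorem derivTestBound_succ {k : ℕ} (hk : 2 ≤ k) (ih : DerivTestBound k) :
    DerivTestBound (k + 1) := by
  intro N N' a l L m hN hl hL hm ha h1 h2 h3
  rcases le_or_gt 1 m with hm1 | hm1
  · exact norm_sum_expChar_le_of_one_le a hN hm1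
  rw [pow_succ 2 k, pow_mul] at h1 h2 h3
  obtain ⟨H, hH1, hHN, hHa, hHb, hHc⟩ := exists_shift_step hk hl hL hm hm1 h1 h2 h3
  have hL0 : 0 < L := by linarith
  have hHp : (0 : ℝ) < H := by exact_mod_cast hH1
  set E := 2 ^ k with hE
  have hE4 : 4 ≤ E := by
    calc 4 = 2 ^ 2 := rfl
      _ ≤ 2 ^ k := Nat.pow_le_pow_right (by norm_num) hk
  have hE4r : (4 : ℝ) ≤ E := by exact_mod_cast hE4
  set s : ℝ := 1 / (E : ℝ) with hs
  have hs0 : 0 ≤ s := by positivity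
  have hs1 : s ≤ 1 / 4 := one_div_le_one_div_of_le (by norm_num) hE4r
  refine norm_sum_expChar_le_of_differenced a N N' H m
    (fun h => m ^ 2 / 5.75 * ((H : ℝ) / h) ^ s) hN hH1 hHN hm.le ?_ ?_
  · intro h hh1 hhH
    have hhp : (0 : ℝ) < h := by exact_mod_cast hh1
    have hhr : (h : ℝ) ≤ H := by exact_mod_cast hhH.le
    have hq1 : 1 ≤ (H : ℝ) / h := by rwa [one_le_div hhp]
    have hw1 : 1 ≤ ((H : ℝ) / h) ^ s := Real.one_le_rpow hq1 hs0
    have hwE : (((H : ℝ) / h) ^ s) ^ E = H / h := by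
      rw [hs, one_div]
      exact Real.rpow_inv_natCast_pow (by positivity) (by omega)
    set w := ((H : ℝ) / h) ^ s with hw
    have hw0 : 0 < w := by linarith
    have hd := fwdDiff_iter_sub_shift_bounds a (k + 1) h N' l L ha
    -- The shorter sum is still measured against `N`, which is why `DerivTestBound` separates the
    -- two lengths.
    apply ih N (N' - h) (fun i => a (i + h) - a i) (h * l) (h * L) (m ^ 2 / 5.75 * w) (by omega)
      (by positivity) (by gcongr) (by positivity) hd
    · calc (h : ℝ) * L ≤ h * (l * N * ((m / 7.4) ^ E) ^ 2) := by gcongr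
        _ = h * l * N * ((m / 7.4) ^ 2) ^ E := by rw [← pow_mul, mul_comm E 2, pow_mul]; ring
        _ ≤ h * l * N * (m ^ 2 / 5.75 * w / 7.4) ^ E := by
          gcongr
          calc (m / 7.4) ^ 2 = m ^ 2 * (1 / 7.4 ^ 2) := by ring
            _ ≤ m ^ 2 * (1 / (5.75 * 7.4)) := by gcongr; norm_num
            _ = m ^ 2 / 5.75 * 1 / 7.4 := by ring
            _ ≤ _ := by gcongr
    · have hw2 : w ^ 2 ≤ (w ^ E) ^ 2 := by
        gcongr
        exact le_self_pow₀ hw1 (by omega)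
      have e1 : (m ^ 2 / 5.75 * w / 5.75) ^ E = ((m / 5.75) ^ E) ^ 2 * w ^ E := by
        rw [← pow_mul, mul_comm E 2, pow_mul, ← mul_pow]
        congr 1
        ring
      rw [e1]
      calc (h * L) ^ 2 * (m ^ 2 / 5.75 * w / 5.75) ^ 2
          = h * (h / H) * (H * L ^ 2 * (m / 5.75) ^ 4) * w ^ 2 := by field_simp
        _ ≤ h * 1 * (l * (((m / 5.75) ^ E) ^ 2) ^ 2) * (w ^ E) ^ 2 := by
          gcongr
          rwa [div_le_one hHp]
        _ = _ := by ring
    · have e1 : (m ^ 2 / 5.75 * w / 10.8) ^ E = (m ^ 2 / (5.75 * 10.8)) ^ E * w ^ E := by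
        rw [← mul_pow]
        congr 1
        ring
      rw [e1, hwE]
      calc 1 ≤ H * l * N ^ (k + 1) * (m ^ 2 / (5.75 * 10.8)) ^ E := hHc
        _ = _ := by field_simp
  · rw [← Finset.mul_sum]
    -- As `s ≤ 1/4`, the weights average to at most `4/3`; `16/3/5.75 + 2/32 < 1` completes the
    -- step.
    have e1 := sum_Ico_div_rpow_le hs0 (by linarith) H
    have e2 : (H : ℝ) / (1 - s) ≤ 4 / 3 * H := by
      rw [div_le_iff₀ (by linarith)]
      nlinarith
    have e3 : m ^ 2 / 5.75 * ∑ h ∈ Finset.Ico 1 H, ((H : ℝ) / h) ^ s ≤ m ^ 2 / 5.75 * (4 / 3 * H) := by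
      gcongr
      linarith
    have e4 : m ^ 2 / 5.75 * (4 / 3 * H) = 4 / 3 / 5.75 * (H * m ^ 2) := by ring
    rw [e4] at e3
    norm_num at e3 hHa ⊢
    linarith

theorem derivTestBound {k : ℕ} (hk : 2 ≤ k) : DerivTestBound k := by
  induction k, hk using Nat.le_induction with
  | base => exact derivTestBound_two
  | succ k hk ih => exact derivTestBound_succ hk ih

/-! ### From derivatives to forward differences -/

theorem hasDerivAt_fwdDiff_iter (k : ℕ) (F F' : ℝ → ℝ) (y : ℝ)
    (h : ∀ i : ℕ, i ≤ k → HasDerivAt F (F' (y + i)) (y + i)) :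
    HasDerivAt ((fwdDiff 1)^[k] F) ((fwdDiff 1)^[k] F' y) y := by
  induction k generalizing y with
  | zero => simpa using h 0 le_rfl
  | succ k ih =>
    rw [Function.iterate_succ_apply', Function.iterate_succ_apply']
    have h1 := ih y fun i hi => h i (by omega)
    have h2 := ih (y + 1) fun i hi => by
      have := h (i + 1) (by omega)
      push_cast at this
      rwa [add_assoc, add_comm (1 : ℝ)]
    exact (h2.comp_add_const y 1).sub h1

theorem continuousOn_fwdDiff_iter (k : ℕ) {F : ℝ → ℝ} {a b : ℝ} (h : ContinuousOn F (Set.Ioc a b)) :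
    ContinuousOn ((fwdDiff 1)^[k] F) (Set.Ioc a (b - k)) := by
  induction k with
  | zero => simpa using h
  | succ k ih =>
    rw [Function.iterate_succ_apply']
    refine ContinuousOn.sub ?_ (ih.mono (Set.Ioc_subset_Ioc le_rfl (by push_cast; linarith)))
    refine ih.comp (by fun_prop) fun x hx => ?_
    have h1 := hx.1
    have h2 := hx.2
    push_cast at h2
    exact ⟨by linarith, by linarith⟩

/-- The `k`-th forward difference inherits bounds from the `k`-th derivative. -/
theorem fwdDiff_iter_bounds_of_iteratedDerivWithin (k : ℕ) {a b l L : ℝ} (F : ℝ → ℝ)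
    (hF : ContDiffOn ℝ k F (Set.Ioc a b))
    (hb : ∀ x ∈ Set.Ioc a b, l ≤ iteratedDerivWithin k F (Set.Ioc a b) x ∧
      iteratedDerivWithin k F (Set.Ioc a b) x ≤ L) (x : ℝ) (hx : a < x) (hxb : x + k ≤ b) :
    l ≤ (fwdDiff 1)^[k] F x ∧ (fwdDiff 1)^[k] F x ≤ L := by
  induction k generalizing F x with
  | zero =>
    have := hb x ⟨hx, by simpa using hxb⟩
    simpa using this
  | succ k ih =>
    push_cast at hxb
    have hu : UniqueDiffOn ℝ (Set.Ioc a b) := uniqueDiffOn_Ioc a b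
    have hF1 : ContDiffOn ℝ k (derivWithin F (Set.Ioc a b)) (Set.Ioc a b) :=
      hF.derivWithin hu (by push_cast; rfl)
    -- For `y < x + 1` all points `y + i` stay strictly below `b`, so the derivatives there are
    -- two-sided.
    have hd : ∀ y ∈ Set.Ioo x (x + 1),
        HasDerivAt ((fwdDiff 1)^[k] F) ((fwdDiff 1)^[k] (derivWithin F (Set.Ioc a b)) y) y := by
      intro y hy
      refine hasDerivAt_fwdDiff_iter k F _ y fun i hi => ?_
      have hir : (i : ℝ) ≤ k := by exact_mod_cast hi
      have hi0 : (0 : ℝ) ≤ i := Nat.cast_nonneg _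
      have h1 : a < y + i := by linarith [hy.1]
      have h2 : y + i < b := by linarith [hy.2]
      have h3 : DifferentiableWithinAt ℝ F (Set.Ioc a b) (y + i) :=
        hF.differentiableOn (by simp) _ ⟨h1, h2.le⟩
      exact h3.hasDerivWithinAt.hasDerivAt (Ioc_mem_nhds h1 h2)
    have hc : ContinuousOn ((fwdDiff 1)^[k] F) (Set.Icc x (x + 1)) := by
      refine (continuousOn_fwdDiff_iter k hF.continuousOn).mono fun y hy => ?_
      exact ⟨by linarith [hy.1], by linarith [hy.2]⟩
    -- The mean value theorem gives `Δ^(k+1) F(x) = Δ^k F'(c)`.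
    obtain ⟨c, hc, hcs⟩ := exists_hasDerivAt_eq_slope _ _ (by linarith : x < x + 1) hc hd
    have h := ih (derivWithin F (Set.Ioc a b)) hF1 (fun y hy => by
      have := hb y hy
      rwa [iteratedDerivWithin_succ'] at this) c (by linarith [hc.1]) (by linarith [hc.2])
    rw [hcs, add_sub_cancel_left, div_one] at h
    rw [Function.iterate_succ_apply']
    exact h

/-! ### Passage to real `Y` and the final theorem -/

theorem fwdDiff_iter_comp_natCast (F : ℝ → ℝ) (c : ℝ) (k n : ℕ) :
    (fwdDiff 1)^[k] (fun i : ℕ => F (c + i)) n = (fwdDiff 1)^[k] F (c + n) := by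
  induction k generalizing n with
  | zero => rfl
  | succ k ih =>
    rw [Function.iterate_succ_apply', Function.iterate_succ_apply', fwdDiff, fwdDiff, ih, ih]
    push_cast
    rw [add_assoc]

theorem expSum_eq_sum_range (f : ℝ → ℝ) (X Y : ℝ) :
    expSum f X Y =
      ∑ n ∈ Finset.range (⌊X + Y⌋ - ⌊X⌋).toNat, expChar (f ((⌊X⌋ + 1 : ℝ) + n)) := by
  unfold expSum
  refine (Finset.sum_nbij' (fun n : ℕ => ⌊X⌋ + 1 + (n : ℤ)) (fun n => (n - (⌊X⌋ + 1)).toNat)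
    ?_ ?_ ?_ ?_ ?_).symm
  · intro n hn; simp at hn ⊢; omega
  · intro n hn; simp at hn ⊢; omega
  · intro n hn; simp
  · intro n hn; simp at hn ⊢; omega
  · intro n hn; push_cast; rfl

theorem le_div_pow_of_mul_rpow_le {c r m : ℝ} (hc : 0 < c) (hr : 0 ≤ r) {n : ℕ} (hn : n ≠ 0)
    (h : c * r ^ ((n : ℝ)⁻¹) ≤ m) : r ≤ (m / c) ^ n := by
  have h1 : r ^ ((n : ℝ)⁻¹) ≤ m / c := by
    rw [le_div_iff₀ hc]; linarith
  calc r = (r ^ ((n : ℝ)⁻¹)) ^ n := (Real.rpow_inv_natCast_pow hr hn).symm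
    _ ≤ _ := by gcongr

/-- The derivative test in a form free of real powers. -/
theorem norm_expSum_le {k : ℕ} (hk : 2 ≤ k) {X Y l L m : ℝ} {f : ℝ → ℝ} (hY : 2 ≤ Y)
    (hf : ContDiffOn ℝ (k + 1 : ℕ) f (Set.Ioc X (X + Y))) (hl : 0 < l) (hm : 0 < m)
    (hb : ∀ x ∈ Set.Ioc X (X + Y),
      l ≤ iteratedDerivWithin (k + 1) f (Set.Ioc X (X + Y)) x ∧
        iteratedDerivWithin (k + 1) f (Set.Ioc X (X + Y)) x ≤ L)
    (h1 : L / (l * Y) ≤ (m / 7.49) ^ 2 ^ k)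
    (h2 : L ^ 2 / l ≤ (m / 5.79) ^ (2 ^ (k + 1) - 2))
    (h3 : (l * Y ^ (k + 1))⁻¹ ≤ (m / 10.89) ^ 2 ^ k) :
    ‖expSum f X Y‖ ≤ m * Y := by
  have hY0 : 0 < Y := by linarith
  have hlL : l ≤ L := by
    have := hb (X + Y) ⟨by linarith, le_rfl⟩
    linarith
  set N := ⌊Y⌋₊ + 1 with hN
  set N' := (⌊X + Y⌋ - ⌊X⌋).toNat with hN'
  have hNY : (N : ℝ) ≤ Y + 1 := by
    rw [hN]; push_cast; linarith [Nat.floor_le hY0.le]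
  have hYN : Y ≤ N := by
    rw [hN]; push_cast; exact (Nat.lt_floor_add_one Y).le
  have hNN : N' ≤ N := by
    have e1 : ⌊X + Y⌋ ≤ ⌊X⌋ + ⌊Y⌋ + 1 := by
      have a1 := Int.floor_le (X + Y)
      have a2 := Int.lt_floor_add_one X
      have a3 := Int.lt_floor_add_one Y
      have : (⌊X + Y⌋ : ℝ) < ((⌊X⌋ + ⌊Y⌋ + 2 : ℤ) : ℝ) := by push_cast; linarith
      have : ⌊X + Y⌋ < ⌊X⌋ + ⌊Y⌋ + 2 := by exact_mod_cast this
      omega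
    have e2 : (⌊Y⌋₊ : ℤ) = ⌊Y⌋ := Int.natCast_floor_eq_floor hY0.le
    omega
  rw [expSum_eq_sum_range, ← hN']
  set a : ℕ → ℝ := fun n => f ((⌊X⌋ + 1 : ℝ) + n) with ha
  rcases le_or_gt 1.5 m with hm2 | hm2
  · have e := norm_sum_expChar_le_of_one_le (m := 1) a hNN le_rfl
    refine e.trans ?_
    norm_num at hm2 ⊢
    nlinarith
  set E := 2 ^ k with hE
  have hE4 : 4 ≤ E := by
    calc 4 = 2 ^ 2 := rfl
      _ ≤ 2 ^ k := Nat.pow_le_pow_right (by norm_num) hk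
  -- Exactly what `0.995 (Y + 1) ≤ Y` requires: the target `0.995 m` for `N ≤ Y + 1` yields `m Y`.
  -- The gaps from `7.4`, `5.75`, `10.8` to `7.49`, `5.79`, `10.89` absorb the factor `0.995`.
  have hY199 : 199 ≤ Y := by
    have e1 : 1 / Y ≤ L / (l * Y) := by
      rw [div_le_div_iff₀ hY0 (by positivity)]
      nlinarith
    have e2 : (m / 7.49) ^ E ≤ (1.5 / 7.49) ^ 4 := by
      calc (m / 7.49) ^ E ≤ (1.5 / 7.49) ^ E := by gcongr
        _ ≤ (1.5 / 7.49) ^ 4 := pow_le_pow_of_le_one (by norm_num) (by norm_num) hE4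
    have e3 : (1.5 / 7.49 : ℝ) ^ 4 ≤ 1 / 199 := by norm_num
    have e4 : 1 / Y ≤ 1 / 199 := e1.trans (h1.trans (e2.trans e3))
    exact (one_div_le_one_div hY0 (by norm_num)).1 e4
  have hmain := derivTestBound hk N N' a l L (0.995 * m) hNN hl hlL (by positivity) ?_ ?_ ?_ ?_
  · refine hmain.trans ?_
    calc 0.995 * m * N ≤ 0.995 * m * (Y + 1) := by gcongr
      _ = m * (0.995 * (Y + 1)) := by ring
      _ ≤ m * Y := by gcongr; norm_num; linarith
  · intro n hn
    rw [ha, fwdDiff_iter_comp_natCast]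
    have hx1 := Int.lt_floor_add_one X
    have hx2 := Int.floor_le (X + Y)
    refine fwdDiff_iter_bounds_of_iteratedDerivWithin (k + 1) f hf hb _ ?_ ?_
    · have : (0 : ℝ) ≤ n := Nat.cast_nonneg _
      linarith
    · have e : ⌊X⌋ + 1 + (n : ℤ) + ((k + 1 : ℕ) : ℤ) ≤ ⌊X + Y⌋ := by omega
      have e' : ((⌊X⌋ + 1 + (n : ℤ) + ((k + 1 : ℕ) : ℤ) : ℤ) : ℝ) ≤ (⌊X + Y⌋ : ℝ) := by
        exact_mod_cast e
      push_cast at e' ⊢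
      linarith
  · rw [div_le_iff₀ (by positivity)] at h1
    calc L ≤ (m / 7.49) ^ E * (l * Y) := h1
      _ ≤ (0.995 * m / 7.4) ^ E * (l * N) := by
        gcongr ?_ ^ E * (l * ?_)
        rw [div_le_div_iff₀ (by norm_num) (by norm_num)]
        norm_num
        linarith
      _ = _ := by ring
  · rw [div_le_iff₀ hl] at h2
    have e0 : m / 5.79 ≤ 0.995 * m / 5.75 := by
      rw [div_le_div_iff₀ (by norm_num) (by norm_num)]
      norm_num
      linarith
    set y := 0.995 * m / 5.75 with hy
    have hy0 : 0 < y := by positivity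
    have e1 : (y ^ E) ^ 2 = y ^ (2 ^ (k + 1) - 2) * y ^ 2 := by
      rw [← pow_mul, ← pow_add]
      congr 1
      rw [pow_succ, ← hE]
      omega
    calc L ^ 2 * y ^ 2 ≤ (m / 5.79) ^ (2 ^ (k + 1) - 2) * l * y ^ 2 := by gcongr
      _ ≤ y ^ (2 ^ (k + 1) - 2) * l * y ^ 2 := by gcongr
      _ = _ := by rw [e1]; ring
  · have hp : 0 < l * Y ^ (k + 1) := by positivity
    rw [inv_le_iff_one_le_mul₀ hp] at h3
    refine h3.trans ?_
    calc (m / 10.89) ^ E * (l * Y ^ (k + 1)) ≤ (0.995 * m / 10.8) ^ E * (l * N ^ (k + 1)) := by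
          gcongr ?_ ^ E * (l * ?_ ^ (k + 1))
          rw [div_le_div_iff₀ (by norm_num) (by norm_num)]
          norm_num
          linarith
      _ = _ := by ring

theorem theoremT :
    ∃ A B C : ℕ → ℝ,
      (∀ d : ℕ, 3 ≤ d →
        (0 < A d ∧ A d < 7.5) ∧ (0 < B d ∧ B d < 5.8) ∧ (0 < C d ∧ C d < 10.9)) ∧
      ∀ (d : ℕ) (X Y lam Lam : ℝ) (f : ℝ → ℝ),
        3 ≤ d →
        (d : ℤ) < ⌊Y⌋ →
        ContDiffOn ℝ d f (Set.Ioc X (X + Y)) →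
        0 < lam →
        (∀ x ∈ Set.Ioc X (X + Y),
          lam ≤ iteratedDerivWithin d f (Set.Ioc X (X + Y)) x ∧
          iteratedDerivWithin d f (Set.Ioc X (X + Y)) x ≤ Lam) →
        ‖(1 / (Y : ℂ)) * expSum f X Y‖ ≤
          max (max (A d * (Lam / (lam * Y)) ^ ((2 : ℝ) / 2 ^ d))
            (B d * (Lam ^ 2 / lam) ^ ((1 : ℝ) / (2 ^ d - 2))))
            (C d * (lam * Y ^ d) ^ (-((2 : ℝ) / 2 ^ d))) := by
  refine ⟨fun _ => 7.49, fun _ => 5.79, fun _ => 10.89, fun d _ => by norm_num, ?_⟩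
  intro d X Y lam Lam f hd hY hf hlam hb
  obtain ⟨k, rfl⟩ : ∃ k, d = k + 1 := ⟨d - 1, by omega⟩
  have hk : 2 ≤ k := by omega
  have hY1 : 2 ≤ Y := by
    have e1 : (2 : ℤ) ≤ ⌊Y⌋ := by omega
    have e2 : ((2 : ℤ) : ℝ) ≤ ⌊Y⌋ := by exact_mod_cast e1
    push_cast at e2
    linarith [Int.floor_le Y]
  have hY0 : 0 < Y := by linarith
  have hLam : 0 < Lam := by
    have := hb (X + Y) ⟨by linarith, le_rfl⟩
    linarith
  have hexp : (2 : ℝ) / 2 ^ (k + 1) = ((2 ^ k : ℕ) : ℝ)⁻¹ := by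
    push_cast
    rw [pow_succ]
    field_simp
  have h4 : 4 ≤ 2 ^ k := by
    calc 4 = 2 ^ 2 := rfl
      _ ≤ 2 ^ k := Nat.pow_le_pow_right (by norm_num) hk
  have hexp2 : (1 : ℝ) / (2 ^ (k + 1) - 2) = ((2 ^ (k + 1) - 2 : ℕ) : ℝ)⁻¹ := by
    rw [Nat.cast_sub (by rw [pow_succ]; omega), one_div]
    push_cast
    rfl
  beta_reduce
  rw [Real.rpow_neg (by positivity), ← Real.inv_rpow (by positivity), hexp, hexp2]
  -- The target is the claimed bound itself; each term being at most `m` yields, after clearing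
  -- roots, one hypothesis of `norm_expSum_le`.
  set m := max (max (7.49 * (Lam / (lam * Y)) ^ (((2 ^ k : ℕ) : ℝ)⁻¹))
    (5.79 * (Lam ^ 2 / lam) ^ (((2 ^ (k + 1) - 2 : ℕ) : ℝ)⁻¹)))
    (10.89 * ((lam * Y ^ (k + 1))⁻¹) ^ (((2 ^ k : ℕ) : ℝ)⁻¹)) with hm
  have hm0 : 0 < m := lt_of_lt_of_le (by positivity) (le_max_right _ _)
  have h := norm_expSum_le hk hY1 hf hlam hm0 hb
    (le_div_pow_of_mul_rpow_le (by norm_num) (by positivity) (by omega)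
      ((le_max_left _ _).trans (le_max_left _ _)))
    (le_div_pow_of_mul_rpow_le (by norm_num) (by positivity) (by rw [pow_succ]; omega)
      ((le_max_right _ _).trans (le_max_left _ _)))
    (le_div_pow_of_mul_rpow_le (by norm_num) (by positivity) (by omega) (le_max_right _ _))
  rw [norm_mul, norm_div, norm_one, Complex.norm_real, Real.norm_of_nonneg hY0.le,
    one_div_mul_eq_div, div_le_iff₀ hY0]
  exact h
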